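/- Let $n$ buyers have values $v_1,\dots,v_n>0$ for a single item, and let each buyer $i$ choose a bid $b_i$ in a compact interval $[B_{\min},B_{\max}]$, where $0<B_{\min}\le B_{\max}<\infty$. Given a weight function $w$ that is positive on $[B_{\min},B_{\max}]$, the quasi-proportional mechanism gives the item to buyer $i$ with probability $w(b_i)/\sum_{j=1}^n w(b_j)$. In the all-pay game the utility of buyer $i$ is $$u_i(b)=v_i\,\frac{w(b_i)}{\sum_{j=1}^n w(b_j)}-b_i ,$$ and in the winners-pay game it is $$u_i(b)=\frac{w(b_i)}{\sum_{j=1}^n w(b_j)}\,(v_i-b_i).$$ A pure Nash equilibrium is a bid vector $b^*\in[B_{\min},B_{\max}]^n$ such that $u_i(b^*)\ge u_i(b_i',b^*_{-i})$ for every buyer $i$ and every $b_i'\in[B_{\min},B_{\max}]$. (1) If $w$ is continuous, concave and positive on $[B_{\min},B_{\max}]$, then the all-pay game has exactly one pure Nash equilibrium. (2) If $w(x)=x^\gamma$ with $0<\gamma\le 1$, then the winners-pay game has exactly one pure Nash equilibrium. -/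

import Mathlib

/-- `b` is a pure Nash equilibrium of the game in which player `i` chooses a strategy in `S i`
and receives `u i b` under the strategy profile `b`. -/
def IsPureNash {n : ℕ} (S : Fin n → Set ℝ) (u : Fin n → (Fin n → ℝ) → ℝ)
    (b : Fin n → ℝ) : Prop :=
  (∀ i, b i ∈ S i) ∧ ∀ i, ∀ x ∈ S i, u i (Function.update b i x) ≤ u i b

/-- The probability with which the quasi-proportional mechanism with weight function `w`
allocates the item to buyer `i` under the bid vector `b`. -/
noncomputable def winProb {n : ℕ} (w : ℝ → ℝ) (i : Fin n) (b : Fin n → ℝ) : ℝ :=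
  w (b i) / ∑ j, w (b j)

/-- The utility of buyer `i` in the all-pay quasi-proportional mechanism with values `v`. -/
noncomputable def allPayUtility {n : ℕ} (w : ℝ → ℝ) (v : Fin n → ℝ) (i : Fin n)
    (b : Fin n → ℝ) : ℝ :=
  v i * winProb w i b - b i

/-- The utility of buyer `i` in the winners-pay quasi-proportional mechanism with values `v`. -/
noncomputable def winnersPayUtility {n : ℕ} (w : ℝ → ℝ) (v : Fin n → ℝ) (i : Fin n)
    (b : Fin n → ℝ) : ℝ :=
  winProb w i b * (v i - b i)

open Set

/-! Both games are aggregative: buyer `i` sees the others only through the total weight `T`. With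
`T` treated as a parameter, the first-order condition has exactly one solution `β i T`, continuous
in `T`, and equilibria are the solutions of `∑ W (β i T) = T`. The intermediate value theorem gives
one. Shares sum to `1` at every equilibrium while each strictly decreases in `T`, so there is no
second (`existsUnique_of_share_decreasing`). For each game it remains to show that the first-order
condition characterises best responses, is solvable for every `T > 0`, and gives decreasing shares.
-/

/-! ### Aggregative games. -/

/-- If the equilibrium condition of every player `i` is a closed condition `R i T b` on the
aggregate `T = ∑ j, W (b j)` and the own strategy `b`, solvable for every `T > 0`, and shares
`W b / T` of solutions strictly decrease in `T`, then there is exactly one equilibrium. -/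
theorem existsUnique_of_share_decreasing {n : ℕ} {l u : ℝ} {W : ℝ → ℝ} (hW : Continuous W)
    (hpos : ∀ x ∈ Icc l u, 0 < W x) {R : Fin n → ℝ → ℝ → Prop}
    (hex : ∀ i T, 0 < T → ∃ b ∈ Icc l u, R i T b)
    (hcl : ∀ i, IsClosed {p : ℝ × ℝ | R i p.1 p.2})
    (hmono : ∀ i T T' b b', 0 < T → T ≤ T' → b ∈ Icc l u → b' ∈ Icc l u → R i T b → R i T' b' →
      W b * T' ≤ W b' * T → T = T' ∧ b = b') :
    ∃! b : Fin n → ℝ, (∀ i, b i ∈ Icc l u) ∧ ∀ i, R i (∑ j, W (b j)) (b i) := by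
  rcases Nat.eq_zero_or_pos n with rfl | hn
  · exact ⟨Fin.elim0, ⟨fun i => i.elim0, fun i => i.elim0⟩, fun b _ => Subsingleton.elim _ _⟩
  have : NeZero n := ⟨hn.ne'⟩
  have hsum : ∀ b : Fin n → ℝ, (∀ i, b i ∈ Icc l u) → 0 < ∑ j, W (b j) := fun b hb =>
    Finset.sum_pos (fun i _ => hpos _ (hb i)) Finset.univ_nonempty
  have huniq : ∀ i T b b', 0 < T → b ∈ Icc l u → b' ∈ Icc l u → R i T b → R i T b' → b = b' := by
    intro i T b b' hT hb hb' h h'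
    rcases le_total (W b) (W b') with hw | hw
    · exact (hmono i T T b b' hT le_rfl hb hb' h h' (by gcongr)).2
    · exact (hmono i T T b' b hT le_rfl hb' hb h' h (by gcongr)).2.symm
  have key : ∀ b b' : Fin n → ℝ, (∀ i, b i ∈ Icc l u) → (∀ i, b' i ∈ Icc l u) →
      (∀ i, R i (∑ j, W (b j)) (b i)) → (∀ i, R i (∑ j, W (b' j)) (b' i)) →
      ∑ j, W (b j) ≤ ∑ j, W (b' j) → b = b' := by
    intro b b' hb hb' h h' hle
    -- Both sides sum to the product of the two aggregates, so some player's share does not fall.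
    obtain ⟨i, -, hi⟩ := Finset.exists_le_of_sum_le (s := Finset.univ)
      (f := fun i => W (b i) * ∑ j, W (b' j)) (g := fun i => W (b' i) * ∑ j, W (b j))
      Finset.univ_nonempty (by rw [← Finset.sum_mul, ← Finset.sum_mul, mul_comm])
    have hT := (hmono i _ _ _ _ (hsum b hb) hle (hb i) (hb' i) (h i) (h' i) hi).1
    funext j
    exact huniq j _ _ _ (hsum b hb) (hb j) (hb' j) (h j) (hT ▸ h' j)
  have hne : (Icc l u).Nonempty := by
    obtain ⟨b, hb, -⟩ := hex 0 1 one_pos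
    exact ⟨b, hb⟩
  obtain ⟨b, hb, h⟩ : ∃ b : Fin n → ℝ, (∀ i, b i ∈ Icc l u) ∧ ∀ i, R i (∑ j, W (b j)) (b i) := by
    choose β hβmem hβ using fun (i : Fin n) (T : Ioi (0 : ℝ)) => hex i T T.2
    let β' : Fin n → Ioi (0 : ℝ) → Icc l u := fun i T => ⟨β i T, hβmem i T⟩
    have hβc : ∀ i, Continuous (β' i) := by
      intro i
      -- Closed graph argument: projecting away the compact strategy factor is a closed map.
      refine continuous_iff_isClosed.2 fun C hC => ?_
      have : β' i ⁻¹' C = Prod.fst '' ((fun p : Ioi (0 : ℝ) × Icc l u => ((p.1 : ℝ), (p.2 : ℝ))) ⁻¹'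
          {p : ℝ × ℝ | R i p.1 p.2} ∩ Prod.snd ⁻¹' C) := by
        ext T
        constructor
        · exact fun hT => ⟨(T, β' i T), ⟨hβ i T, hT⟩, rfl⟩
        · rintro ⟨⟨T, b⟩, ⟨h, hbC⟩, rfl⟩
          have : β' i T = b := Subtype.ext (huniq i T _ _ T.2 (hβmem i T) b.2 (hβ i T) h)
          simpa [this] using hbC
      rw [this]
      exact isClosedMap_fst_of_compactSpace _
        (((hcl i).preimage (by fun_prop)).inter (hC.preimage continuous_snd))
    obtain ⟨xm, hxm, hm⟩ := isCompact_Icc.exists_isMinOn hne hW.continuousOn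
    obtain ⟨xM, hxM, hM⟩ := isCompact_Icc.exists_isMaxOn hne hW.continuousOn
    have hc : Continuous fun T : Ioi (0 : ℝ) => ∑ i, W (β' i T) := by
      have := fun i => (hβc i)
      fun_prop
    have hnM : 0 < n * W xM := mul_pos (by exact_mod_cast hn) (hpos _ hxM)
    obtain ⟨T, hT⟩ : ∃ T : Ioi (0 : ℝ), ∑ i, W (β' i T) = T := by
      have : PreconnectedSpace (Ioi (0 : ℝ)) :=
        isPreconnected_iff_preconnectedSpace.1 isPreconnected_Ioi
      -- The sum is at most `T` at `T = n * max W`, and at least `T` at `T = min W`, where one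
      -- summand suffices.
      have := mem_range_of_exists_le_of_exists_ge (c := 0)
        (hc.sub continuous_subtype_val) ⟨⟨n * W xM, hnM⟩, ?_⟩ ⟨⟨W xm, hpos _ hxm⟩, ?_⟩
      · obtain ⟨T, hT⟩ := this
        exact ⟨T, sub_eq_zero.1 hT⟩
      · have := Finset.sum_le_card_nsmul Finset.univ
          (fun i => W (β' i ⟨n * W xM, hnM⟩)) (W xM) (fun i _ => hM (β' i _).2)
        simpa using this
      · have := Finset.single_le_sum (f := fun i => W (β' i ⟨W xm, hpos _ hxm⟩))
          (fun i _ => (hpos _ (β' i _).2).le) (Finset.mem_univ (0 : Fin n))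
        have h0 : W xm ≤ W (β' 0 ⟨W xm, hpos _ hxm⟩) := hm (β' 0 _).2
        exact sub_nonneg.2 (h0.trans this)
    refine ⟨fun i => β i T, fun i => hβmem i T, fun i => ?_⟩
    have hT' : ∑ j, W (β j T) = T := hT
    rw [hT']
    exact hβ i T
  refine ⟨b, ⟨hb, h⟩, fun b' ⟨hb', h'⟩ => ?_⟩
  rcases le_total (∑ j, W (b j)) (∑ j, W (b' j)) with hle | hle
  · exact (key b b' hb hb' h h' hle).symm
  · exact key b' b hb' hb h' h hle


/-! ### The all-pay game. -/

theorem le_of_forall_small_le_add_mul {a b c : ℝ} (h : ∀ t, 0 < t → t ≤ 1 → a ≤ b + t * c) :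
    a ≤ b := by
  by_contra! hab
  have hc : 0 < |c| + 1 := by positivity
  have h0 : 0 < (a - b) / 2 / (|c| + 1) := by
    have := sub_pos.2 hab
    positivity
  have h1 := h (min 1 ((a - b) / 2 / (|c| + 1))) (lt_min one_pos h0) (min_le_left _ _)
  have h2 : min 1 ((a - b) / 2 / (|c| + 1)) * c ≤ (a - b) / 2 / (|c| + 1) * (|c| + 1) :=
    (mul_le_mul_of_nonneg_left ((le_abs_self c).trans (by linarith))
      (lt_min one_pos h0).le).trans (mul_le_mul_of_nonneg_right (min_le_right _ _) hc.le)
  rw [div_mul_cancel₀ _ hc.ne'] at h2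
  linarith

/-- The first-order optimality condition of a buyer with value `v` who bids `b` in the all-pay
game with aggregate weight `T`. -/
def AllPayOpt (l u : ℝ) (w : ℝ → ℝ) (v T b : ℝ) : Prop :=
  ∀ x ∈ Icc l u, v * max (T - w b) 0 * (w x - w b) ≤ T ^ 2 * (x - b)

theorem isClosed_allPayOpt {l u v : ℝ} {w : ℝ → ℝ} (hw : Continuous w) :
    IsClosed {p : ℝ × ℝ | AllPayOpt l u w v p.1 p.2} := by
  simp only [AllPayOpt, ofPred_forall]
  refine isClosed_iInter fun x => isClosed_iInter fun _ => isClosed_le ?_ ?_ <;> fun_prop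

theorem ConcaveOn.le_lineMap_Icc {l u : ℝ} {w : ℝ → ℝ} (hw : ConcaveOn ℝ (Icc l u) w) {b x t : ℝ}
    (hb : b ∈ Icc l u) (hx : x ∈ Icc l u) (ht : 0 < t) (ht1 : t ≤ 1) :
    b + t * (x - b) ∈ Icc l u ∧ w b + t * (w x - w b) ≤ w (b + t * (x - b)) := by
  have e : (1 - t) • b + t • x = b + t * (x - b) := by simp only [smul_eq_mul]; ring
  have h1 := hw.1 hb hx (sub_nonneg.2 ht1) ht.le (by ring)
  have h2 := hw.2 hb hx (sub_nonneg.2 ht1) ht.le (by ring)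
  rw [e] at h1 h2
  simp only [smul_eq_mul] at h2
  exact ⟨h1, by linarith⟩

/-- The condition is the first-order condition for maximising `v * h (w x) - T ^ 2 * x`, where `h' y
= max (T - y) 0`. Since `h'` is 1-Lipschitz, `h` lies above its tangents up to a quadratic error,
which vanishes along shrinking segments towards `b`. -/
theorem exists_allPayOpt {l u v T : ℝ} {w : ℝ → ℝ} (hlu : l ≤ u) (hv : 0 < v)
    (hw : ConcaveOn ℝ (Icc l u) w) (hc : ContinuousOn w (Icc l u)) :
    ∃ b ∈ Icc l u, AllPayOpt l u w v T b := by
  let h : ℝ → ℝ := fun y => T * y - y ^ 2 / 2 + max (y - T) 0 ^ 2 / 2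
  have hh : ∀ y z, h y + max (T - y) 0 * (z - y) - (z - y) ^ 2 / 2 ≤ h z := by
    intro y z
    simp only [h]
    rcases le_total T y with h1 | h1 <;> rcases le_total T z with h2 | h2 <;>
      simp [h1, h2] <;> nlinarith [mul_nonneg (sub_nonneg.2 h1) (sub_nonneg.2 h2)]
  have hm : Monotone h := by
    intro y z hyz
    simp only [h]
    rcases le_total T y with h1 | h1 <;> rcases le_total T z with h2 | h2 <;>
      simp [h1, h2] <;> nlinarith [mul_nonneg (sub_nonneg.2 h1) (sub_nonneg.2 h2)]
  have hhc : Continuous h := by fun_prop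
  obtain ⟨b, hb, hmax⟩ := isCompact_Icc.exists_isMaxOn (nonempty_Icc.2 hlu)
    (f := fun x => v * h (w x) - T ^ 2 * x)
    ((continuousOn_const.mul (hhc.comp_continuousOn hc)).sub (by fun_prop))
  refine ⟨b, hb, fun x hx => ?_⟩
  refine le_of_forall_small_le_add_mul (c := v * (w x - w b) ^ 2 / 2) fun t ht ht1 => ?_
  obtain ⟨hmem, hle⟩ := hw.le_lineMap_Icc hb hx ht ht1
  have h1 : v * h (w (b + t * (x - b))) - T ^ 2 * (b + t * (x - b)) ≤ v * h (w b) - T ^ 2 * b :=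
    hmax hmem
  have h2 := mul_le_mul_of_nonneg_left ((hh (w b) (w b + t * (w x - w b))).trans (hm hle)) hv.le
  refine le_of_mul_le_mul_left ?_ ht
  nlinarith

/-- With share `s = w b / T`, the marginal gain per unit of weight is `v * (1 - s) / T` for `s ≤ 1`,
decreasing in both `s` and `T`. Testing each bid against the other gives the opposite inequality. -/
theorem AllPayOpt.eq_of_share_le {l u v T T' b b' : ℝ} {w : ℝ → ℝ} (hv : 0 < v)
    (hpos : ∀ x ∈ Icc l u, 0 < w x) (hT : 0 < T) (hTT : T ≤ T') (hb : b ∈ Icc l u)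
    (hb' : b' ∈ Icc l u) (h : AllPayOpt l u w v T b) (h' : AllPayOpt l u w v T' b')
    (hs : w b * T' ≤ w b' * T) : T = T' ∧ b = b' := by
  have hT' := hT.trans_le hTT
  have hwb := hpos b hb
  have hle : w b ≤ w b' := by
    refine le_of_mul_le_mul_right (hs.trans ?_) hT'
    exact mul_le_mul_of_nonneg_left hTT (hpos b' hb').le
  have h1 := h b' hb'
  have h2 := h' b hb
  have hTeq : w b = w b' → T = T' ∧ b = b' := by
    intro e
    rw [e] at h1 hs
    rw [e] at h2
    rw [sub_self, mul_zero] at h1 h2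
    have h3 := nonneg_of_mul_nonneg_right h1 (by positivity)
    have h4 := nonneg_of_mul_nonneg_right h2 (by positivity)
    exact ⟨le_antisymm hTT (le_of_mul_le_mul_left hs (hpos b' hb')), by linarith⟩
  rcases hle.eq_or_lt with e | hlt
  · exact hTeq e
  exfalso
  -- the bid with the larger share faces the smaller marginal gain
  have h3 := mul_le_mul_of_nonneg_left h1 (sq_nonneg T')
  have h4 := mul_le_mul_of_nonneg_left h2 (sq_nonneg T)
  have hd := sub_pos.2 hlt
  have h5 : T' ^ 2 * max (T - w b) 0 ≤ T ^ 2 * max (T' - w b') 0 := by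
    have : v * (w b' - w b) * (T' ^ 2 * max (T - w b) 0) ≤
        v * (w b' - w b) * (T ^ 2 * max (T' - w b') 0) := by linarith
    exact le_of_mul_le_mul_left this (by positivity)
  -- If the truncation is active at `b'`, both marginal gains vanish and only cost matters, forcing
  -- `b = b'`.
  rcases le_or_gt T' (w b') with h6 | h6
  · have e' : max (T' - w b') 0 = 0 := max_eq_right (by linarith)
    rw [e', mul_zero] at h5 h2
    have e : max (T - w b) 0 = 0 :=
      le_antisymm (nonpos_of_mul_nonpos_right h5 (by positivity)) (le_max_right _ _)
    rw [zero_mul] at h2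
    rw [e, mul_zero, zero_mul] at h1
    have h7 := nonneg_of_mul_nonneg_right h1 (by positivity)
    have h8 := nonneg_of_mul_nonneg_right h2 (by positivity)
    have : b = b' := by linarith
    exact hlt.ne (by rw [this])
  · rw [max_eq_left (by linarith : 0 ≤ T' - w b')] at h5
    have h7 : T' ^ 2 * (T - w b) ≤ T ^ 2 * (T' - w b') :=
      (mul_le_mul_of_nonneg_left (le_max_left _ _) (sq_nonneg _)).trans h5
    have h8 : T' * (T - w b) ≥ T * (T' - w b') := by linarith
    have h9 : T' * (T * (T' - w b')) ≤ T * (T * (T' - w b')) := by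
      have := mul_le_mul_of_nonneg_left h8 hT'.le
      linarith
    have e : T = T' :=
      le_antisymm hTT (le_of_mul_le_mul_right h9 (mul_pos hT (sub_pos.2 h6)))
    subst e
    have := le_of_mul_le_mul_left h7 (by positivity)
    linarith

/-- Necessity: deviate a fraction `t` towards `x`, bound `w` below by its chord, and let `t` tend to
`0`. Sufficiency: replacing `w x + S` by `w b + S` costs a term with the sign of `(w x - w b) * (x -
b)`, harmful only when a higher bid buys no more weight, and such a bid cannot pay. -/
theorem allPayOpt_iff_utility_le {l u v S b : ℝ} {w : ℝ → ℝ} (hv : 0 < v)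
    (hw : ConcaveOn ℝ (Icc l u) w) (hpos : ∀ x ∈ Icc l u, 0 < w x) (hS : 0 ≤ S)
    (hb : b ∈ Icc l u) :
    (∀ x ∈ Icc l u, v * (w x / (w x + S)) - x ≤ v * (w b / (w b + S)) - b) ↔
      AllPayOpt l u w v (w b + S) b := by
  have hwb := hpos b hb
  have hP : 0 < w b + S := by positivity
  have hkey : ∀ x y, 0 < y → (v * (y / (y + S)) - x ≤ v * (w b / (w b + S)) - b ↔
      v * S * (y - w b) ≤ (x - b) * ((y + S) * (w b + S))) := by
    intro x y hy
    have e : v * (y / (y + S)) - v * (w b / (w b + S)) =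
        v * S * (y - w b) / ((y + S) * (w b + S)) := by
      field_simp
      ring
    rw [← div_le_iff₀ (by positivity), ← e]
    constructor <;> intro <;> linarith
  have e : max (w b + S - w b) 0 = S := by rw [add_sub_cancel_left, max_eq_left hS]
  simp only [AllPayOpt, e]
  constructor
  · intro h x hx
    refine le_of_forall_small_le_add_mul (c := (w x - w b) * (w b + S) * (x - b))
      fun t ht ht1 => ?_
    obtain ⟨hmem, hle⟩ := hw.le_lineMap_Icc hb hx ht ht1
    have hy : 0 < w b + t * (w x - w b) := by
      have : 0 < t * w x := mul_pos ht (hpos x hx)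
      nlinarith [mul_nonneg (sub_nonneg.2 ht1) hwb.le]
    have hshare : (w b + t * (w x - w b)) / (w b + t * (w x - w b) + S) ≤
        w (b + t * (x - b)) / (w (b + t * (x - b)) + S) := by
      rw [div_le_div_iff₀ (by positivity) (add_pos_of_pos_of_nonneg (hy.trans_le hle) hS)]
      nlinarith [mul_le_mul_of_nonneg_right hle hS]
    have h1 := (hkey (b + t * (x - b)) _ hy).1
      ((sub_le_sub_right (mul_le_mul_of_nonneg_left hshare hv.le) _).trans (h _ hmem))
    refine le_of_mul_le_mul_left ?_ ht
    linarith
  · intro h x hx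
    rw [hkey x _ (hpos x hx)]
    have h1 := h x hx
    have h2 : 0 ≤ v * S := by positivity
    rcases le_total (w b) (w x) with hd | hd
    · have hxb : 0 ≤ x - b := nonneg_of_mul_nonneg_right
        ((mul_nonneg h2 (sub_nonneg.2 hd)).trans h1) (by positivity)
      have := mul_nonneg (mul_nonneg hxb (sub_nonneg.2 hd)) hP.le
      linarith
    · rcases le_total b x with hxb | hxb
      · refine (mul_nonpos_of_nonneg_of_nonpos h2 (sub_nonpos.2 hd)).trans ?_
        have := hpos x hx
        exact mul_nonneg (sub_nonneg.2 hxb) (by positivity)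
      · have := mul_nonneg (mul_nonneg (sub_nonneg.2 hxb) (sub_nonneg.2 hd)) hP.le
        linarith

/-! ### The winners-pay game. -/

/-- The first-order optimality condition of a buyer with value `v` who bids `b` in the
winners-pay game with weight function `x ↦ x ^ γ` and aggregate weight `T`. -/
def WinnersPayOpt (l u γ v T b : ℝ) : Prop :=
  ∀ x ∈ Icc l u, (γ * (v - b) * max (T - b ^ γ) 0 - T * b) * (x - b) ≤ 0

theorem isClosed_winnersPayOpt {l u γ v : ℝ} (hγ : 0 < γ) :
    IsClosed {p : ℝ × ℝ | WinnersPayOpt l u γ v p.1 p.2} := by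
  simp only [WinnersPayOpt, ofPred_forall]
  have h : Continuous fun p : ℝ × ℝ => p.2 ^ γ :=
    (Real.continuous_rpow_const hγ.le).comp continuous_snd
  refine isClosed_iInter fun x => isClosed_iInter fun _ => isClosed_le ?_ ?_ <;> fun_prop

/-- A continuous function on an interval satisfies the complementarity condition of a
one-dimensional variational inequality somewhere. -/
theorem ContinuousOn.exists_mul_sub_nonpos {l u : ℝ} {F : ℝ → ℝ} (hlu : l ≤ u)
    (hF : ContinuousOn F (Icc l u)) : ∃ b ∈ Icc l u, ∀ x ∈ Icc l u, F b * (x - b) ≤ 0 := by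
  rcases le_total (F l) 0 with hl | hl
  · exact ⟨l, left_mem_Icc.2 hlu, fun x hx =>
      mul_nonpos_of_nonpos_of_nonneg hl (sub_nonneg.2 hx.1)⟩
  rcases le_total 0 (F u) with hu | hu
  · exact ⟨u, right_mem_Icc.2 hlu, fun x hx =>
      mul_nonpos_of_nonneg_of_nonpos hu (sub_nonpos.2 hx.2)⟩
  obtain ⟨b, hb, h⟩ := intermediate_value_Icc' hlu hF ⟨hu, hl⟩
  exact ⟨b, hb, fun x _ => by rw [h, zero_mul]⟩

theorem exists_winnersPayOpt {l u γ v T : ℝ} (hlu : l ≤ u) (hγ : 0 < γ) :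
    ∃ b ∈ Icc l u, WinnersPayOpt l u γ v T b := by
  have h : Continuous fun b : ℝ => b ^ γ := Real.continuous_rpow_const hγ.le
  exact ContinuousOn.exists_mul_sub_nonpos hlu
    (F := fun b => γ * (v - b) * max (T - b ^ γ) 0 - T * b) (by fun_prop)

/-- Divided by `T`, the marginal condition compares `γ * (v - b) * (1 - s)` with `b`. If `b < b'`
and the share has not fallen, the left side has not risen while the right side has. -/
theorem WinnersPayOpt.eq_of_share_le {l u γ v T T' b b' : ℝ} (hl : 0 < l) (hγ : 0 < γ)
    (hT : 0 < T) (hTT : T ≤ T') (hb : b ∈ Icc l u) (hb' : b' ∈ Icc l u)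
    (h : WinnersPayOpt l u γ v T b) (h' : WinnersPayOpt l u γ v T' b')
    (hs : b ^ γ * T' ≤ b' ^ γ * T) : T = T' ∧ b = b' := by
  have hT' := hT.trans_le hTT
  have h0 : 0 < b := hl.trans_le hb.1
  have h0' : 0 < b' := hl.trans_le hb'.1
  have hw' := Real.rpow_pos_of_pos h0' γ
  have hle : b ≤ b' := by
    rw [← Real.rpow_le_rpow_iff h0.le h0'.le hγ]
    exact le_of_mul_le_mul_right (hs.trans (mul_le_mul_of_nonneg_left hTT hw'.le)) hT'
  rcases hle.eq_or_lt with rfl | hlt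
  · exact ⟨le_antisymm hTT (le_of_mul_le_mul_left hs hw'), rfl⟩
  exfalso
  have h1 : γ * (v - b) * max (T - b ^ γ) 0 - T * b ≤ 0 :=
    nonpos_of_mul_nonpos_left (h b' hb') (sub_pos.2 hlt)
  have h2 : 0 ≤ γ * (v - b') * max (T' - b' ^ γ) 0 - T' * b' := by
    have := h' b hb
    by_contra! hneg
    exact this.not_gt (mul_pos_of_neg_of_neg hneg (sub_neg.2 hlt))
  have h3 : 0 < γ * (v - b') * max (T' - b' ^ γ) 0 :=
    (mul_pos hT' h0').trans_le (sub_nonneg.1 h2)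
  have h4 : 0 < max (T' - b' ^ γ) 0 := by
    refine (le_max_right _ _).lt_of_ne fun e => ?_
    rw [← e, mul_zero] at h3
    exact h3.false
  have h5 : 0 < v - b' := by
    have := pos_of_mul_pos_left h3 h4.le
    exact pos_of_mul_pos_right this hγ.le
  have h6 : T * max (T' - b' ^ γ) 0 ≤ T' * max (T - b ^ γ) 0 := by
    rw [mul_max_of_nonneg _ _ hT.le, mul_max_of_nonneg _ _ hT'.le, mul_zero, mul_zero]
    exact max_le_max (by linarith) le_rfl
  have h7 : γ * (v - b') * (T' * max (T - b ^ γ) 0) ≤ γ * (v - b) * (T' * max (T - b ^ γ) 0) := by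
    gcongr
  have h8 := mul_le_mul_of_nonneg_left h6 (mul_pos hγ h5).le
  have h9 := mul_le_mul_of_nonneg_left h1 hT'.le
  have h10 := mul_le_mul_of_nonneg_left h2 hT.le
  have h11 : 0 < T * T' * (b' - b) := mul_pos (mul_pos hT hT') (sub_pos.2 hlt)
  linarith

theorem hasDerivAt_winnersPay {γ v S x : ℝ} (hx : 0 < x) (hS : 0 ≤ S) :
    HasDerivAt (fun x : ℝ => x ^ γ / (x ^ γ + S) * (v - x))
      (x ^ γ / (x * (x ^ γ + S) ^ 2) * (γ * (v - x) * S - (x ^ γ + S) * x)) x := by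
  have hw := Real.rpow_pos_of_pos hx γ
  have h := Real.hasDerivAt_rpow_const (p := γ) (Or.inl hx.ne')
  refine ((h.div (h.add_const S) (by positivity)).mul
    ((hasDerivAt_id x).const_sub v)).congr_deriv ?_
  rw [Real.rpow_sub_one hx.ne']
  simp only [id, Pi.div_apply]
  field_simp
  ring

/-- The derivative of the utility is a positive factor times the antitone `g`, so the utility rises
and then falls, and the first-order condition is sufficient. -/
theorem winnersPayOpt_iff_utility_le {l u γ v S b : ℝ} (hl : 0 < l) (hγ : 0 < γ)
    (hS : 0 ≤ S) (hb : b ∈ Icc l u) :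
    (∀ x ∈ Icc l u, x ^ γ / (x ^ γ + S) * (v - x) ≤ b ^ γ / (b ^ γ + S) * (v - b)) ↔
      WinnersPayOpt l u γ v (b ^ γ + S) b := by
  have hpos : ∀ x ∈ Icc l u, 0 < x := fun x hx => hl.trans_le hx.1
  set g : ℝ → ℝ := fun x => γ * (v - x) * S - (x ^ γ + S) * x with hg
  set f : ℝ → ℝ := fun x => x ^ γ / (x ^ γ + S) * (v - x) with hf
  have hder : ∀ x ∈ Icc l u, HasDerivAt f (x ^ γ / (x * (x ^ γ + S) ^ 2) * g x) x :=
    fun x hx => hasDerivAt_winnersPay (hpos x hx) hS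
  have hcoef : ∀ x ∈ Icc l u, 0 < x ^ γ / (x * (x ^ γ + S) ^ 2) := fun x hx => by
    have := hpos x hx
    positivity
  have hganti : AntitoneOn g (Icc l u) := by
    intro x hx y hy hxy
    have hx0 := hpos x hx
    have h1 : x ^ γ ≤ y ^ γ := by gcongr
    have h2 : γ * (v - y) * S ≤ γ * (v - x) * S := by gcongr
    have h3 : (x ^ γ + S) * x ≤ (y ^ γ + S) * y := by
      have := hpos y hy
      gcongr
    simp only [hg]
    linarith
  have e : max (b ^ γ + S - b ^ γ) 0 = S := by rw [add_sub_cancel_left, max_eq_left hS]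
  simp only [WinnersPayOpt, e]
  change (∀ x ∈ Icc l u, f x ≤ f b) ↔ ∀ x ∈ Icc l u, g b * (x - b) ≤ 0
  constructor
  · intro h x hx
    have hmax : IsLocalMaxOn f (Icc l u) b := IsMaxOn.localize h
    have h1 := hmax.hasFDerivWithinAt_nonpos (hder b hb).hasFDerivAt.hasFDerivWithinAt
      (sub_mem_posTangentConeAt_of_segment_subset ((convex_Icc l u).segment_subset hb hx))
    simp only [ContinuousLinearMap.toSpanSingleton_apply, smul_eq_mul] at h1
    refine nonpos_of_mul_nonpos_right (a := b ^ γ / (b * (b ^ γ + S) ^ 2)) ?_ (hcoef b hb)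
    linarith
  · intro h x hx
    rcases lt_trichotomy b x with hlt | rfl | hlt
    · have hgb : g b ≤ 0 := nonpos_of_mul_nonpos_left (h x hx) (sub_pos.2 hlt)
      have hsub : Icc b x ⊆ Icc l u := Icc_subset_Icc hb.1 hx.2
      refine antitoneOn_of_hasDerivWithinAt_nonpos (convex_Icc b x)
        (fun y hy => (hder y (hsub hy)).continuousAt.continuousWithinAt)
        (fun y hy => (hder y (hsub (interior_subset hy))).hasDerivWithinAt)
        (fun y hy => ?_) (left_mem_Icc.2 hlt.le) (right_mem_Icc.2 hlt.le) hlt.le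
      have hy := interior_subset hy
      exact mul_nonpos_of_nonneg_of_nonpos (hcoef y (hsub hy)).le
        ((hganti hb (hsub hy) hy.1).trans hgb)
    · exact le_rfl
    · have hgb : 0 ≤ g b := by
        by_contra! hneg
        exact (h x hx).not_gt (mul_pos_of_neg_of_neg hneg (sub_neg.2 hlt))
      have hsub : Icc x b ⊆ Icc l u := Icc_subset_Icc hx.1 hb.2
      refine monotoneOn_of_hasDerivWithinAt_nonneg (convex_Icc x b)
        (fun y hy => (hder y (hsub hy)).continuousAt.continuousWithinAt)
        (fun y hy => (hder y (hsub (interior_subset hy))).hasDerivWithinAt)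
        (fun y hy => ?_) (left_mem_Icc.2 hlt.le) (right_mem_Icc.2 hlt.le) hlt.le
      have hy := interior_subset hy
      exact mul_nonneg (hcoef y (hsub hy)).le (hgb.trans (hganti (hsub hy) hb hy.2))

/-! ### From Nash equilibria to first-order conditions. -/

theorem winProb_update {n : ℕ} (w : ℝ → ℝ) (i : Fin n) (b : Fin n → ℝ) (x : ℝ) :
    winProb w i (Function.update b i x) =
      w x / (w x + ∑ j ∈ Finset.univ.erase i, w (b j)) := by
  rw [winProb, ← Finset.add_sum_erase _ _ (Finset.mem_univ i), Function.update_self]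
  congr 2
  exact Finset.sum_congr rfl fun j hj => by
    rw [Function.update_of_ne (Finset.ne_of_mem_erase hj)]

theorem winProb_eq {n : ℕ} (w : ℝ → ℝ) (i : Fin n) (b : Fin n → ℝ) :
    winProb w i b = w (b i) / (w (b i) + ∑ j ∈ Finset.univ.erase i, w (b j)) := by
  rw [← winProb_update, Function.update_eq_self]

theorem isPureNash_allPay_iff {n : ℕ} {l u : ℝ} {w : ℝ → ℝ} {v : Fin n → ℝ} (hv : ∀ i, 0 < v i)
    (hw : ConcaveOn ℝ (Icc l u) w) (hpos : ∀ x ∈ Icc l u, 0 < w x) (b : Fin n → ℝ) :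
    IsPureNash (fun _ => Icc l u) (allPayUtility w v) b ↔
      (∀ i, b i ∈ Icc l u) ∧ ∀ i, AllPayOpt l u w (v i) (∑ j, w (b j)) (b i) := by
  refine and_congr_right fun hb => forall_congr' fun i => ?_
  rw [← Finset.add_sum_erase _ _ (Finset.mem_univ i), ← allPayOpt_iff_utility_le (hv i) hw hpos
    (Finset.sum_nonneg fun j _ => (hpos _ (hb j)).le) (hb i)]
  simp only [allPayUtility, winProb_update, Function.update_self, winProb_eq w i b]

theorem isPureNash_winnersPay_iff {n : ℕ} {l u γ : ℝ} {v : Fin n → ℝ} (hl : 0 < l) (hγ : 0 < γ)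
    (b : Fin n → ℝ) :
    IsPureNash (fun _ => Icc l u) (winnersPayUtility (fun x => x ^ γ) v) b ↔
      (∀ i, b i ∈ Icc l u) ∧ ∀ i, WinnersPayOpt l u γ (v i) (∑ j, b j ^ γ) (b i) := by
  refine and_congr_right fun hb => forall_congr' fun i => ?_
  rw [← Finset.add_sum_erase _ _ (Finset.mem_univ i), ← winnersPayOpt_iff_utility_le hl hγ
    (Finset.sum_nonneg fun j _ => Real.rpow_nonneg (hl.le.trans (hb j).1) γ) (hb i)]
  simp only [winnersPayUtility, winProb_update, Function.update_self,
    winProb_eq (fun x : ℝ => x ^ γ) i b]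

theorem existsUnique_isPureNash_allPay {n : ℕ} {l u : ℝ} (hlu : l ≤ u) {w : ℝ → ℝ}
    {v : Fin n → ℝ} (hv : ∀ i, 0 < v i) (hw : ConcaveOn ℝ (Icc l u) w)
    (hc : ContinuousOn w (Icc l u)) (hpos : ∀ x ∈ Icc l u, 0 < w x) :
    ∃! b : Fin n → ℝ, IsPureNash (fun _ => Icc l u) (allPayUtility w v) b := by
  -- Constant extension beyond the endpoints makes the weight continuous on all of `ℝ` without
  -- changing it on the bid interval.
  set W := IccExtend hlu ((Icc l u).domRestrict w) with hWdef
  have hWw : EqOn W w (Icc l u) := fun x hx => by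
    rw [hWdef, IccExtend_of_mem _ _ hx, domRestrict_apply]
  have hWc : Continuous W := hc.domRestrict.Icc_extend'
  have hWpos : ∀ x ∈ Icc l u, 0 < W x := fun x hx => hWw hx ▸ hpos x hx
  have hR := existsUnique_of_share_decreasing hWc hWpos
    (R := fun i T b => AllPayOpt l u W (v i) T b)
    (fun i T _ => exists_allPayOpt hlu (hv i) (hw.congr hWw.symm) hWc.continuousOn)
    (fun i => isClosed_allPayOpt hWc)
    (fun i T T' b b' hT hTT hb hb' h h' hs => h.eq_of_share_le (hv i) hWpos hT hTT hb hb' h' hs)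
  refine (existsUnique_congr fun b => ?_).2 hR
  rw [isPureNash_allPay_iff hv hw hpos]
  refine and_congr_right fun hb => forall_congr' fun i => forall₂_congr fun x hx => ?_
  rw [Finset.sum_congr rfl fun j _ => hWw (hb j), hWw (hb i), hWw hx]

theorem existsUnique_isPureNash_winnersPay {n : ℕ} {l u γ : ℝ} (hl : 0 < l) (hlu : l ≤ u)
    {v : Fin n → ℝ} (hγ : 0 < γ) :
    ∃! b : Fin n → ℝ, IsPureNash (fun _ => Icc l u) (winnersPayUtility (fun x => x ^ γ) v) b := by
  have hR := existsUnique_of_share_decreasing (W := fun x => x ^ γ) (l := l) (u := u)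
    (Real.continuous_rpow_const hγ.le) (fun x hx => Real.rpow_pos_of_pos (hl.trans_le hx.1) γ)
    (R := fun i T b => WinnersPayOpt l u γ (v i) T b)
    (fun i T _ => exists_winnersPayOpt hlu hγ) (fun i => isClosed_winnersPayOpt hγ)
    (fun i T T' b b' hT hTT hb hb' h h' hs => h.eq_of_share_le hl hγ hT hTT hb hb' h' hs)
  exact (existsUnique_congr fun b => isPureNash_winnersPay_iff hl hγ b).2 hR

theorem mainTheorem1 (n : ℕ) (Bmin Bmax : ℝ) (hBmin : 0 < Bmin) (hB : Bmin ≤ Bmax)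
    (v : Fin n → ℝ) (hv : ∀ i, 0 < v i) :
    (∀ w : ℝ → ℝ, ConcaveOn ℝ (Set.Icc Bmin Bmax) w → ContinuousOn w (Set.Icc Bmin Bmax) →
      (∀ x ∈ Set.Icc Bmin Bmax, 0 < w x) →
      ∃! b : Fin n → ℝ, IsPureNash (fun _ => Set.Icc Bmin Bmax) (allPayUtility w v) b) ∧
    (∀ γ : ℝ, 0 < γ → γ ≤ 1 →
      ∃! b : Fin n → ℝ, IsPureNash (fun _ => Set.Icc Bmin Bmax)
        (winnersPayUtility (fun x => x ^ γ) v) b) :=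
  ⟨fun _ hw hc hpos => existsUnique_isPureNash_allPay hB hv hw hc hpos,
    fun _ hγ _ => existsUnique_isPureNash_winnersPay hBmin hB hγ⟩
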